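/- There exist infinitely many pairs of cospectral cubic graphs with different chromatic index. More precisely, there is an infinite sequence $(G_i,H_i)_{i\in\mathbb N}$ of pairs of finite simple cubic (i.e. $3$-regular) graphs such that for every $i$ the graphs $G_i$ and $H_i$ are cospectral (their adjacency matrices have the same eigenvalues with the same multiplicities), $G_i$ has chromatic index $3$ and $H_i$ has chromatic index $4$, and such that for all $i\neq j$ the graphs $G_i$ and $G_j$ are not isomorphic and the graphs $H_i$ and $H_j$ are not isomorphic. Here the chromatic index of a graph is the minimum number of colors in a coloring of its edges in which any two distinct edges sharing a vertex have different colors. -/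

import Mathlib

namespace SimpleGraph

/-- An edge-coloring: edges that are distinct and share a vertex get different colors. -/
def IsProperEdgeColoring {V K : Type*} {G : SimpleGraph V} (c : G.EdgeLabeling K) : Prop :=
  ∀ e f : G.edgeSet, e ≠ f → (∃ v : V, v ∈ (e : Sym2 V) ∧ v ∈ (f : Sym2 V)) → c e ≠ c f

/-- The chromatic index: the minimum number of colors in an edge-coloring
(`⊤` if no finite number of colors suffices, which never happens for finite graphs). -/
noncomputable def chromaticIndex {V : Type*} (G : SimpleGraph V) : ℕ∞ :=
  ⨅ k ∈ {k : ℕ | ∃ c : G.EdgeLabeling (Fin k), IsProperEdgeColoring c}, (k : ℕ∞)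

open Classical in
/-- A finite graph is cubic if it is regular of degree 3. -/
def IsCubic {V : Type*} [Fintype V] (G : SimpleGraph V) : Prop :=
  G.IsRegularOfDegree 3

open Classical in
/-- The spectrum of a finite graph: the multiset of eigenvalues, with multiplicities, of its
adjacency matrix. That matrix is real symmetric, so all its eigenvalues are real. -/
noncomputable def adjSpectrum {V : Type*} [Fintype V] [DecidableEq V] (G : SimpleGraph V) :
    Multiset ℝ :=
  (G.adjMatrix ℝ).charpoly.roots

/-- Two finite graphs are cospectral if their adjacency matrices have the same spectrum. -/
def Cospectral {V W : Type*} [Fintype V] [DecidableEq V] [Fintype W] [DecidableEq W]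
    (G : SimpleGraph V) (H : SimpleGraph W) : Prop :=
  G.adjSpectrum = H.adjSpectrum

end SimpleGraph

/-! One pair suffices, because truncation (replacing every vertex of a cubic graph by a triangle)
produces further pairs. It keeps the graph cubic and triples the number of vertices. In both
directions it preserves 3-edge-colorability: at a triangle, each side has the color of the outer
edge at the opposite corner (`EdgeColorableBy.truncation`, `EdgeColorableBy.of_truncation`). The
first of these works for any color set, so 4-colorings extend too. Truncation also preserves
cospectrality: its characteristic polynomial at x is the original one at x² - x - 3, up to a factor
depending only on the number of vertices (`charpoly_truncation_eval_mul`,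
`charpoly_truncation_congr`). The starting pair has 16 vertices. An explicit invertible matrix
intertwines the two adjacency matrices, and finite checks settle the colorings. The iterates have 16
· 3 ^ i vertices, hence are pairwise non-isomorphic. -/

namespace SimpleGraph

open Finset Matrix Polynomial

/-! ### Edge-colorings as functions on pairs of vertices -/

section EdgeColoring

variable {V W K : Type*} {G : SimpleGraph V}

/-- `f` assigns to the pairs of vertices colors that restrict to a proper edge-coloring of `G`. -/
structure IsEdgeColoringFun (G : SimpleGraph V) (f : V → V → K) : Prop where
  symm : ∀ u v, f u v = f v u
  ne : ∀ u v w, G.Adj u v → G.Adj u w → v ≠ w → f u v ≠ f u w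

/-- The edges of `G` can be properly colored with the elements of `K`. -/
def EdgeColorableBy (G : SimpleGraph V) (K : Type*) : Prop :=
  ∃ f : V → V → K, G.IsEdgeColoringFun f

/-- Total functions avoid the subtype of edges, so they are easy to transport and to tabulate. The
price is a default color off the edges, hence `Nonempty K`. -/
theorem exists_isProperEdgeColoring_iff [Nonempty K] :
    (∃ c : G.EdgeLabeling K, IsProperEdgeColoring c) ↔ G.EdgeColorableBy K := by
  classical
  constructor
  · rintro ⟨c, hc⟩
    have key : ∀ u v (h : G.Adj u v), c ⟨s(v, u), h.symm⟩ = c ⟨s(u, v), h⟩ := by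
      intro u v h
      congr 1
      exact Subtype.ext Sym2.eq_swap
    refine ⟨fun u v => if h : G.Adj u v then c ⟨s(u, v), h⟩ else Classical.arbitrary K, ?_, ?_⟩
    · intro u v
      by_cases h : G.Adj u v
      · simp only [h, h.symm, dif_pos]
        exact (key u v h).symm
      · simp only [h, mt G.adj_symm h, dif_neg, not_false_eq_true]
    · intro u v w hv hw hvw
      simp only [hv, hw, dif_pos]
      refine hc _ _ ?_ ⟨u, by simp, by simp⟩
      intro he
      have := congrArg Subtype.val he
      simp only [Sym2.eq_iff] at this
      rcases this with ⟨-, h⟩ | ⟨h1, h2⟩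
      · exact hvw h
      · exact hvw (h2.trans h1)
  · rintro ⟨f, hf⟩
    refine ⟨fun e => Sym2.lift ⟨f, hf.symm⟩ e.1, ?_⟩
    rintro ⟨e, he⟩ ⟨e', he'⟩ hne ⟨v, hv, hv'⟩
    obtain ⟨a, rfl⟩ := hv
    obtain ⟨b, rfl⟩ := hv'
    exact hf.ne v a b he he' fun h => hne (by subst h; rfl)

theorem EdgeColorableBy.of_iso {H : SimpleGraph W} (h : G.EdgeColorableBy K) (e : H ≃g G) :
    H.EdgeColorableBy K := by
  obtain ⟨f, hf⟩ := h
  exact ⟨fun u v => f (e u) (e v), fun u v => hf.symm _ _, fun u v w hv hw hvw =>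
    hf.ne _ _ _ (e.map_adj_iff.2 hv) (e.map_adj_iff.2 hw) (e.injective.ne hvw)⟩

/-- Fewer than `k` colors embed into `k`, so excluding `k` is enough. The exclusion speaks of
labelings because `Fin k` may be empty. -/
theorem chromaticIndex_eq_succ {k : ℕ} (h : G.EdgeColorableBy (Fin (k + 1)))
    (h' : ¬ ∃ c : G.EdgeLabeling (Fin k), IsProperEdgeColoring c) :
    G.chromaticIndex = ((k + 1 : ℕ) : ℕ∞) := by
  unfold chromaticIndex
  refine le_antisymm (iInf₂_le (k + 1) (exists_isProperEdgeColoring_iff.2 h)) ?_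
  refine le_iInf₂ fun m hm => ?_
  by_contra hlt
  have hmk : m ≤ k := by
    have : m < k + 1 := by exact_mod_cast not_le.1 hlt
    omega
  obtain ⟨c, hc⟩ := hm
  exact h' ⟨fun e => Fin.castLE hmk (c e),
    fun e f hne hv heq => hc e f hne hv (Fin.castLE_injective hmk heq)⟩

end EdgeColoring

/-! ### Neighborhoods in cubic graphs -/

section Cubic

variable {V W : Type*} [Fintype V] [Fintype W] {G : SimpleGraph V}

theorem isCubic_iff [DecidableRel G.Adj] : G.IsCubic ↔ ∀ v, G.degree v = 3 := by
  unfold IsCubic IsRegularOfDegree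
  refine forall_congr' fun v => ?_
  convert Iff.rfl

theorem IsCubic.of_iso {H : SimpleGraph W} (h : G.IsCubic) (e : H ≃g G) : H.IsCubic := by
  classical
  rw [isCubic_iff] at h ⊢
  intro v
  rw [← e.degree_eq, h]

/-- In a cubic graph, two neighbors of a vertex are complemented by a unique third one. -/
theorem IsCubic.exists_third (h : G.IsCubic) {v a b : V} (ha : G.Adj v a) (hb : G.Adj v b)
    (hab : a ≠ b) : ∃ c, G.Adj v c ∧ c ≠ a ∧ c ≠ b ∧
      ∀ x, G.Adj v x → x = a ∨ x = b ∨ x = c := by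
  classical
  have h3 : #(G.neighborFinset v) = 3 := isCubic_iff.1 h v
  have hsub : ({a, b} : Finset V) ⊆ G.neighborFinset v := by
    intro x hx
    simp only [Finset.mem_insert, Finset.mem_singleton] at hx
    rcases hx with rfl | rfl <;> simpa
  have h1 : #(G.neighborFinset v \ {a, b}) = 1 := by
    rw [Finset.card_sdiff_of_subset hsub, h3, Finset.card_pair hab]
  obtain ⟨c, hc⟩ := Finset.card_eq_one.1 h1
  have hmem : ∀ x, (G.Adj v x ∧ ¬ (x = a ∨ x = b)) ↔ x = c := by
    intro x
    simpa using Finset.ext_iff.1 hc x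
  have hcc := (hmem c).2 rfl
  refine ⟨c, hcc.1, fun h => hcc.2 (.inl h), fun h => hcc.2 (.inr h), fun x hx => ?_⟩
  by_cases hxa : x = a
  · exact .inl hxa
  by_cases hxb : x = b
  · exact .inr (.inl hxb)
  exact .inr (.inr ((hmem x).1 ⟨hx, by tauto⟩))

theorem IsCubic.exists_adj_ne (h : G.IsCubic) (v : V) :
    ∃ a b, G.Adj v a ∧ G.Adj v b ∧ a ≠ b := by
  classical
  have h3 : #(G.neighborFinset v) = 3 := isCubic_iff.1 h v
  obtain ⟨a, ha, b, hb, hab⟩ := Finset.one_lt_card.1 (by omega : 1 < #(G.neighborFinset v))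
  exact ⟨a, b, by simpa using ha, by simpa using hb, hab⟩

theorem IsCubic.not_edgeColorableBy_two [Nonempty V] (h : G.IsCubic) :
    ¬ G.EdgeColorableBy (Fin 2) := by
  rintro ⟨f, hf⟩
  obtain ⟨a, b, ha, hb, hab⟩ := h.exists_adj_ne (Classical.arbitrary V)
  obtain ⟨c, hc, hca, hcb, -⟩ := h.exists_third ha hb hab
  have h1 := hf.ne _ _ _ ha hb hab
  have h2 := hf.ne _ _ _ hc ha hca
  have h3 := hf.ne _ _ _ hc hb hcb
  omega

end Cubic

/-! ### Truncation and 3-edge-colorings -/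

section Truncation

variable {V K : Type*} {G : SimpleGraph V}

/-- The truncation of a graph: each vertex `v` is replaced by a complete graph on the darts
that start at `v`, and each dart is joined to its reverse. -/
def truncation (G : SimpleGraph V) : SimpleGraph G.Dart where
  Adj d e := d ≠ e ∧ (e = d.symm ∨ d.fst = e.fst)
  symm := ⟨fun d e h => ⟨h.1.symm, h.2.imp (fun h => by rw [h, Dart.symm_symm]) Eq.symm⟩⟩
  loopless := ⟨fun d h => h.1 rfl⟩

theorem truncation_adj {d e : G.Dart} :
    G.truncation.Adj d e ↔ d ≠ e ∧ (e = d.symm ∨ d.fst = e.fst) := Iff.rfl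

theorem Dart.fst_ne_symm_fst (d : G.Dart) : d.fst ≠ d.symm.fst := d.fst_ne_snd

theorem truncation_adj_symm (d : G.Dart) : G.truncation.Adj d d.symm :=
  ⟨d.symm_ne.symm, .inl rfl⟩

theorem Dart.snd_ne_of_fst_eq {d e : G.Dart} (hne : d ≠ e) (h : d.fst = e.fst) :
    d.snd ≠ e.snd :=
  fun h' => hne (Dart.ext _ _ (Prod.ext h h'))

theorem IsCubic.truncation [Fintype V] [DecidableEq V] [DecidableRel G.Adj] (h : G.IsCubic) :
    G.truncation.IsCubic := by
  classical
  rw [isCubic_iff] at h ⊢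
  intro d
  have hn : G.truncation.neighborFinset d =
      insert d.symm ((univ.filter fun e : G.Dart => e.fst = d.fst).erase d) := by
    ext e
    simp only [mem_neighborFinset, truncation_adj, Finset.mem_insert, Finset.mem_erase,
      Finset.mem_filter, Finset.mem_univ, true_and]
    constructor
    · rintro ⟨h1, h2 | h2⟩
      · exact .inl h2
      · exact .inr ⟨h1.symm, h2.symm⟩
    · rintro (rfl | ⟨h1, h2⟩)
      · exact truncation_adj_symm d
      · exact ⟨h1.symm, .inr h2.symm⟩
  rw [← card_neighborFinset_eq_degree, hn, Finset.card_insert_of_notMem, Finset.card_erase_of_mem,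
    dart_fst_fiber_card_eq_degree, h]
  · simp
  · simp only [Finset.mem_erase, Finset.mem_filter, Finset.mem_univ, true_and, not_and]
    exact fun _ h => d.fst_ne_symm_fst h.symm

theorem IsCubic.card_dart [Fintype V] [DecidableEq V] [DecidableRel G.Adj] (h : G.IsCubic) :
    Fintype.card G.Dart = 3 * Fintype.card V := by
  rw [dart_card_eq_sum_degrees, Finset.sum_congr rfl fun v _ => isCubic_iff.1 h v]
  simp [mul_comm]

/-- A proper edge-coloring of a cubic graph extends to its truncation: an edge of a triangle gets
the color of the edge that leaves the triangle at the opposite vertex. -/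
theorem EdgeColorableBy.truncation [Fintype V] (hG : G.IsCubic) (h : G.EdgeColorableBy K) :
    G.truncation.EdgeColorableBy K := by
  classical
  obtain ⟨f, hf⟩ := h
  by_cases hV : IsEmpty V
  · exact ⟨fun d => hV.elim d.fst, fun d => hV.elim d.fst, fun d => hV.elim d.fst⟩
  have : Nonempty V := not_isEmpty_iff.1 hV
  -- The third neighbor of `v`. The defining predicate is symmetric in `a` and `b`, so the choice is
  -- too, even for junk arguments.
  let t : V → V → V → V := fun v a b => Classical.epsilon fun c => G.Adj v c ∧ c ≠ a ∧ c ≠ b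
  have t_symm : ∀ v a b, t v a b = t v b a := by
    intro v a b
    simp only [t, and_comm (a := _ ≠ a)]
  have t_eq : ∀ v a b c, G.Adj v a → G.Adj v b → G.Adj v c → a ≠ b → c ≠ a → c ≠ b →
      t v a b = c := by
    intro v a b c ha hb hc hab hca hcb
    obtain ⟨h1, h2, h3⟩ := Classical.epsilon_spec
      (⟨c, hc, hca, hcb⟩ : ∃ c, G.Adj v c ∧ c ≠ a ∧ c ≠ b)
    obtain ⟨c', -, -, -, hall⟩ := hG.exists_third ha hb hab
    have e1 : t v a b = c' := by
      rcases hall _ h1 with h | h | h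
      exacts [absurd h h2, absurd h h3, h]
    have e2 : c = c' := by
      rcases hall _ hc with h | h | h
      exacts [absurd h hca, absurd h hcb, h]
    rw [e1, e2]
  have outer : ∀ d e : G.Dart, d ≠ e → d.fst = e.fst →
      f d.fst d.snd ≠ f d.fst (t d.fst d.snd e.snd) := by
    intro d e hne h
    have he : G.Adj d.fst e.snd := h ▸ e.adj
    obtain ⟨c, hc, hcd, hce, -⟩ := hG.exists_third d.adj he (Dart.snd_ne_of_fst_eq hne h)
    rw [t_eq _ _ _ c d.adj he hc (Dart.snd_ne_of_fst_eq hne h) hcd hce]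
    exact hf.ne _ _ _ d.adj hc hcd.symm
  -- `f v₀ v₀` is the constant color off the edges; `K` is not assumed nonempty, which is why empty
  -- `V` was split off.
  have v₀ : V := Classical.arbitrary V
  let g : G.Dart → G.Dart → K := fun d e =>
    if e = d.symm then f d.fst d.snd
    else if d.fst = e.fst then f d.fst (t d.fst d.snd e.snd) else f v₀ v₀
  have g_symm : ∀ d, g d d.symm = f d.fst d.snd := fun d => if_pos rfl
  have g_fst : ∀ d e : G.Dart, d.fst = e.fst → g d e = f d.fst (t d.fst d.snd e.snd) := by
    intro d e h
    have : e ≠ d.symm := fun h' => d.fst_ne_symm_fst (h' ▸ h)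
    simp only [g, if_neg this, if_pos h]
  refine ⟨g, fun d e => ?_, fun d e e' he he' hne => ?_⟩
  · by_cases h : e = d.symm
    · subst h
      have h := g_symm d.symm
      rw [Dart.symm_symm] at h
      rw [g_symm, h]
      exact hf.symm _ _
    · have h' : d ≠ e.symm := fun h' => h (by rw [h', Dart.symm_symm])
      by_cases h2 : d.fst = e.fst
      · rw [g_fst d e h2, g_fst e d h2.symm, t_symm, h2]
      · simp only [g, if_neg h, if_neg h', if_neg h2, if_neg (Ne.symm h2)]
  · obtain ⟨hde, rfl | h1⟩ := he
    · obtain ⟨hde', rfl | h2⟩ := he'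
      · exact absurd rfl hne
      · rw [g_symm, g_fst d e' h2]
        exact outer d e' hde' h2
    · obtain ⟨hde', rfl | h2⟩ := he'
      · rw [g_symm, g_fst d e h1]
        exact (outer d e hde h1).symm
      · rw [g_fst d e h1, g_fst d e' h2]
        have a1 : G.Adj d.fst e.snd := h1 ▸ e.adj
        have a2 : G.Adj d.fst e'.snd := h2 ▸ e'.adj
        have n1 := Dart.snd_ne_of_fst_eq hde h1
        have n2 := Dart.snd_ne_of_fst_eq hde' h2
        have n3 := Dart.snd_ne_of_fst_eq hne (h1.symm.trans h2)
        rw [t_eq _ _ _ _ d.adj a1 a2 n1 n2.symm n3.symm,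
          t_eq _ _ _ _ d.adj a2 a1 n2 n1.symm n3]
        exact hf.ne _ _ _ a2 a1 n3.symm

/-- A proper edge-coloring of the truncation of a cubic graph with three colors contracts to one
of the graph. -/
theorem EdgeColorableBy.of_truncation [Fintype V] (hG : G.IsCubic)
    (h : G.truncation.EdgeColorableBy (Fin 3)) : G.EdgeColorableBy (Fin 3) := by
  classical
  obtain ⟨g, hg⟩ := h
  refine ⟨fun u v => if h : G.Adj u v then g ⟨(u, v), h⟩ ⟨(v, u), h.symm⟩ else 0, ?_, ?_⟩
  · intro u v
    by_cases h : G.Adj u v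
    · simp only [h, h.symm, dif_pos]
      exact hg.symm _ _
    · simp only [h, mt G.adj_symm h, dif_neg, not_false_eq_true]
  · intro v a b ha hb hab
    simp only [ha, hb, dif_pos]
    obtain ⟨c, hc, hca, hcb, -⟩ := hG.exists_third ha hb hab
    have tri : ∀ x y (hx : G.Adj v x) (hy : G.Adj v y), x ≠ y →
        G.truncation.Adj ⟨(v, x), hx⟩ ⟨(v, y), hy⟩ := by
      intro x y hx hy hxy
      exact ⟨fun h => hxy (congrArg (fun d : G.Dart => d.snd) h), .inr rfl⟩
    have dne : ∀ x y (hx : G.Adj v x) (hy : G.Adj v y), x ≠ y →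
        (⟨(v, x), hx⟩ : G.Dart) ≠ ⟨(v, y), hy⟩ :=
      fun x y hx hy hxy => (tri x y hx hy hxy).1
    have opp : ∀ x y (hx : G.Adj v x) (hy : G.Adj v y),
        g ⟨(v, x), hx⟩ ⟨(x, v), hx.symm⟩ ≠ g ⟨(v, x), hx⟩ ⟨(v, y), hy⟩ ∨ x = y := by
      intro x y hx hy
      by_cases hxy : x = y
      · exact .inr hxy
      · exact .inl (hg.ne _ _ _ (truncation_adj_symm ⟨(v, x), hx⟩) (tri x y hx hy hxy)
          fun h => hx.ne (congrArg (fun d : G.Dart => d.fst) h).symm)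
    have o1 := (opp a b ha hb).resolve_right hab
    have o2 := (opp a c ha hc).resolve_right hca.symm
    have o3 := (opp b a hb ha).resolve_right hab.symm
    have o4 := (opp b c hb hc).resolve_right hcb.symm
    have t1 := hg.ne _ _ _ (tri a b ha hb hab) (tri a c ha hc hca.symm) (dne b c hb hc hcb.symm)
    have t2 := hg.ne _ _ _ (tri b a hb ha hab.symm) (tri b c hb hc hcb.symm)
      (dne a c ha hc hca.symm)
    have t3 := hg.ne _ _ _ (tri c a hc ha hca) (tri c b hc hb hcb) (dne a b ha hb hab)
    rw [hg.symm ⟨(v, b), hb⟩ ⟨(v, a), ha⟩] at o3 t2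
    rw [hg.symm ⟨(v, c), hc⟩ ⟨(v, a), ha⟩, hg.symm ⟨(v, c), hc⟩ ⟨(v, b), hb⟩] at t3
    -- The triangle uses all three colors, so the outer edge at a corner must repeat the color of
    -- the opposite side; opposite sides differ.
    omega

end Truncation

/-! ### The characteristic polynomial of a truncation -/

section TruncationSpectrum

variable {V W : Type*} [Fintype V] [DecidableEq V] [Fintype W] [DecidableEq W]

section Matrices

variable (G : SimpleGraph V) [DecidableRel G.Adj]

/-- The incidence matrix of darts and the vertices at which they start. -/
def dartFstMatrix : Matrix G.Dart V ℝ := of fun d v => if d.fst = v then 1 else 0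

/-- The permutation matrix of dart reversal. -/
def dartSymmMatrix : Matrix G.Dart G.Dart ℝ := of fun d e => if e = d.symm then 1 else 0

/-- The incidence matrix of darts and the edges that underlie them. -/
def dartEdgeMatrix : Matrix G.Dart G.edgeFinset ℝ := of fun d e => if d.edge = e then 1 else 0

theorem dartSymmMatrix_mul_apply {n : Type*} (M : Matrix G.Dart n ℝ) (d : G.Dart) (j : n) :
    (G.dartSymmMatrix * M) d j = M d.symm j := by
  simp [dartSymmMatrix, Matrix.mul_apply]

theorem dartSymmMatrix_mul_self : G.dartSymmMatrix * G.dartSymmMatrix = 1 := by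
  ext d e
  rw [dartSymmMatrix_mul_apply]
  simp [dartSymmMatrix, Matrix.one_apply, eq_comm]

omit [DecidableRel G.Adj] in
theorem dartFstMatrix_mul_transpose_apply (d e : G.Dart) :
    (G.dartFstMatrix * G.dartFstMatrixᵀ) d e = if d.fst = e.fst then 1 else 0 := by
  simp [dartFstMatrix, Matrix.mul_apply, eq_comm]

-- The product term joins darts with a common start, including each dart to itself, whence the `-
-- 1`. A dart and its reverse start at different vertices, so nothing is counted twice.
omit [DecidableRel G.Adj] in
theorem adjMatrix_truncation [DecidableRel G.truncation.Adj] :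
    G.truncation.adjMatrix ℝ = G.dartSymmMatrix + G.dartFstMatrix * G.dartFstMatrixᵀ - 1 := by
  ext d e
  rw [Matrix.sub_apply, Matrix.add_apply, dartFstMatrix_mul_transpose_apply, adjMatrix_apply]
  simp only [dartSymmMatrix, of_apply, Matrix.one_apply, truncation_adj]
  by_cases h : d = e
  · subst h
    simp [d.symm_ne.symm]
  by_cases h1 : e = d.symm
  · subst h1
    simp [h, d.fst_ne_snd]
  · simp [h, h1]

theorem dartFstMatrix_transpose_mul_self (h : G.IsCubic) :
    G.dartFstMatrixᵀ * G.dartFstMatrix = (3 : ℝ) • (1 : Matrix V V ℝ) := by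
  ext u v
  simp only [dartFstMatrix, Matrix.mul_apply, transpose_apply, of_apply, ite_mul, one_mul, zero_mul,
    Matrix.smul_apply, Matrix.one_apply, smul_eq_mul]
  by_cases huv : u = v
  · subst huv
    have := G.dart_fst_fiber_card_eq_degree u
    rw [isCubic_iff.1 h] at this
    simp only [if_true, mul_one]
    rw [← Finset.sum_filter, Finset.sum_ite_of_true (by simp)]
    simp [this]
  · rw [Finset.sum_eq_zero]
    · simp [huv]
    · intro d _
      by_cases h1 : d.fst = u
      · simp [h1, huv]
      · simp [h1]

theorem dartFstMatrix_transpose_mul_dartSymmMatrix_mul :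
    G.dartFstMatrixᵀ * (G.dartSymmMatrix * G.dartFstMatrix) = G.adjMatrix ℝ := by
  ext u v
  rw [Matrix.mul_apply]
  simp only [dartSymmMatrix_mul_apply, transpose_apply, adjMatrix_apply]
  simp only [dartFstMatrix, of_apply, Dart.symm_toProd, Prod.fst_swap]
  by_cases h : G.Adj u v
  · rw [Finset.sum_eq_single (⟨(u, v), h⟩ : G.Dart)]
    · simp [h]
    · intro d _ hd
      by_cases h1 : d.fst = u <;> by_cases h2 : d.snd = v <;> simp [h1, h2]
      exact hd (Dart.ext _ _ (Prod.ext h1 h2))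
    · simp
  · rw [if_neg h, Finset.sum_eq_zero]
    intro d _
    by_cases h1 : d.fst = u <;> by_cases h2 : d.snd = v <;> simp [h1, h2]
    exact h (h1 ▸ h2 ▸ d.adj)

theorem dartEdgeMatrix_mul_transpose :
    G.dartEdgeMatrix * G.dartEdgeMatrixᵀ = 1 + G.dartSymmMatrix := by
  ext d e
  simp only [dartEdgeMatrix, dartSymmMatrix, Matrix.mul_apply, transpose_apply, of_apply,
    Matrix.add_apply, Matrix.one_apply]
  rw [Finset.sum_eq_single (⟨d.edge, by simp [d.edge_mem]⟩ : G.edgeFinset)]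
  · have := dart_edge_eq_iff e d
    by_cases h : d = e
    · subst h
      simp [d.symm_ne.symm]
    · simp [this, h, Ne.symm h]
  · intro x _ hx
    rw [if_neg fun h => hx (Subtype.ext h.symm), zero_mul]
  · simp

theorem dartEdgeMatrix_transpose_mul :
    G.dartEdgeMatrixᵀ * G.dartEdgeMatrix = (2 : ℝ) • (1 : Matrix G.edgeFinset G.edgeFinset ℝ) := by
  ext e e'
  simp only [dartEdgeMatrix, Matrix.mul_apply, transpose_apply, of_apply, ite_mul, one_mul, zero_mul,
    Matrix.smul_apply, Matrix.one_apply, smul_eq_mul]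
  by_cases h : e = e'
  · subst h
    have := G.dart_edge_fiber_card e.1 (mem_edgeFinset.1 e.2)
    rw [← Finset.sum_filter, Finset.sum_ite_of_true (by simp)]
    simp [this]
  · rw [Finset.sum_eq_zero]
    · simp [h]
    · intro d _
      by_cases h1 : d.edge = e
      · have : d.edge ≠ e' := fun h2 => h (Subtype.ext (h1.symm.trans h2))
        simp [this]
      · simp [h1]

/-- With E = `dartEdgeMatrix`, the matrix is (y - 1)I + EEᵀ, and EᵀE = 2I, so Sylvester's identity
det(1 + AB) = det(1 + BA) reduces it to a scalar matrix on edges. -/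
theorem det_smul_one_add_dartSymmMatrix {y : ℝ} (hy : y ≠ 1) :
    (y • (1 : Matrix G.Dart G.Dart ℝ) + G.dartSymmMatrix).det =
      (y - 1) ^ Fintype.card G.Dart * ((y + 1) / (y - 1)) ^ #G.edgeFinset := by
  have hy' : y - 1 ≠ 0 := sub_ne_zero.2 hy
  have e1 : y • (1 : Matrix G.Dart G.Dart ℝ) + G.dartSymmMatrix =
      (y - 1) • (1 + ((y - 1)⁻¹ • G.dartEdgeMatrix) * G.dartEdgeMatrixᵀ) := by
    rw [Matrix.smul_mul, dartEdgeMatrix_mul_transpose, smul_add, smul_smul, mul_inv_cancel₀ hy',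
      one_smul, sub_smul, one_smul]
    abel
  have e2 : (1 : Matrix G.edgeFinset G.edgeFinset ℝ) +
      G.dartEdgeMatrixᵀ * ((y - 1)⁻¹ • G.dartEdgeMatrix) = ((y + 1) / (y - 1)) • 1 := by
    rw [Matrix.mul_smul, dartEdgeMatrix_transpose_mul, smul_smul]
    nth_rw 1 [← one_smul ℝ (1 : Matrix G.edgeFinset G.edgeFinset ℝ)]
    rw [← add_smul]
    congr 1
    field_simp
    ring
  rw [e1, det_smul, det_one_add_mul_comm, e2, det_smul, det_one, mul_one, Fintype.card_coe]

/-- At x = y - 1 the characteristic matrix is yI - P - NNᵀ. Since P² = I, multiplying by yI + P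
turns yI - P into the scalar y² - 1. Sylvester's identity then moves the determinant from darts to
vertices, where Nᵀ(yI + P)N = 3yI + A. -/
theorem charpoly_truncation_eval_mul [DecidableRel G.truncation.Adj] (h : G.IsCubic) {y : ℝ}
    (hy : y ^ 2 - 1 ≠ 0) :
    (G.truncation.adjMatrix ℝ).charpoly.eval (y - 1) *
        (y • (1 : Matrix G.Dart G.Dart ℝ) + G.dartSymmMatrix).det =
      (y ^ 2 - 1) ^ Fintype.card G.Dart * ((y ^ 2 - 1)⁻¹ ^ Fintype.card V *
        (G.adjMatrix ℝ).charpoly.eval (y ^ 2 - 1 - 3 * y)) := by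
  set N := G.dartFstMatrix with hN
  set P := G.dartSymmMatrix with hP
  have e1 : scalar G.Dart (y - 1) - G.truncation.adjMatrix ℝ = y • 1 - P - N * Nᵀ := by
    rw [adjMatrix_truncation, scalar_apply, ← smul_one_eq_diagonal (y - 1), sub_smul, one_smul]
    abel
  have e2 : (y • 1 - P - N * Nᵀ) * (y • 1 + P) =
      (y ^ 2 - 1) • (1 - ((y ^ 2 - 1)⁻¹ • N) * (Nᵀ * (y • 1 + P))) := by
    rw [smul_sub, Matrix.smul_mul, smul_smul, mul_inv_cancel₀ hy, one_smul, ← Matrix.mul_assoc,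
      sub_mul]
    congr 1
    have : (y • 1 - P) * (y • 1 + P) = (y * y) • (1 : Matrix G.Dart G.Dart ℝ) - P * P := by
      simp only [sub_mul, mul_add, Matrix.smul_mul, Matrix.mul_smul, Matrix.one_mul, Matrix.mul_one,
        smul_smul]
      abel
    rw [this, hP, dartSymmMatrix_mul_self, sub_smul, one_smul, sq]
  have e3 : 1 - (Nᵀ * (y • 1 + P)) * ((y ^ 2 - 1)⁻¹ • N) =
      (y ^ 2 - 1)⁻¹ • (scalar V (y ^ 2 - 1 - 3 * y) - G.adjMatrix ℝ) := by
    rw [Matrix.mul_smul, Matrix.mul_assoc, Matrix.add_mul, Matrix.smul_mul, Matrix.one_mul,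
      Matrix.mul_add, Matrix.mul_smul, hN, hP, dartFstMatrix_transpose_mul_self _ h,
      dartFstMatrix_transpose_mul_dartSymmMatrix_mul, scalar_apply, ← smul_one_eq_diagonal,
      ← smul_right_injective _ hy |>.eq_iff]
    simp only [smul_sub (y ^ 2 - 1), smul_inv_smul₀ hy, smul_smul y, sub_smul, one_smul, mul_comm y 3]
    abel
  rw [Matrix.eval_charpoly, Matrix.eval_charpoly, e1, ← det_mul, e2, det_smul,
    det_one_sub_mul_comm, e3, det_smul]

end Matrices

theorem charpoly_truncation_congr {G : SimpleGraph V} {H : SimpleGraph W} [DecidableRel G.Adj]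
    [DecidableRel H.Adj] [DecidableRel G.truncation.Adj] [DecidableRel H.truncation.Adj]
    (hG : G.IsCubic) (hH : H.IsCubic)
    (h : (G.adjMatrix ℝ).charpoly = (H.adjMatrix ℝ).charpoly) :
    (G.truncation.adjMatrix ℝ).charpoly = (H.truncation.adjMatrix ℝ).charpoly := by
  have hcard : Fintype.card V = Fintype.card W := by
    have := congrArg natDegree h
    rwa [charpoly_natDegree_eq_dim, charpoly_natDegree_eq_dim] at this
  have hdart : Fintype.card G.Dart = Fintype.card H.Dart := by
    rw [hG.card_dart, hH.card_dart, hcard]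
  have hedge : #G.edgeFinset = #H.edgeFinset := by
    have h1 := G.dart_card_eq_twice_card_edges
    have h2 := H.dart_card_eq_twice_card_edges
    omega
  -- For x > 0, y = x + 1 exceeds 1, so none of the factors to be cancelled vanishes.
  refine Polynomial.eq_of_infinite_eval_eq _ _ ((Set.Ioi_infinite (0 : ℝ)).mono fun x hx => ?_)
  have hx : 0 < x := hx
  obtain ⟨y, rfl⟩ : ∃ y, x = y - 1 := ⟨x + 1, by ring⟩
  have hy : y ≠ 1 := by rintro rfl; simp at hx
  have hy2 : y ^ 2 - 1 ≠ 0 := by nlinarith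
  have e1 := charpoly_truncation_eval_mul G hG hy2
  have e2 := charpoly_truncation_eval_mul H hH hy2
  rw [det_smul_one_add_dartSymmMatrix _ hy] at e1 e2
  rw [h, hcard, hdart, ← e2, hedge] at e1
  have hy3 : (y + 1) / (y - 1) ≠ 0 := div_ne_zero (by linarith) hx.ne'
  exact mul_right_cancel₀ (mul_ne_zero (pow_ne_zero _ hx.ne') (pow_ne_zero _ hy3)) e1

end TruncationSpectrum

/-! ### Graphs and colorings given by tables -/

section NeighborTables

/-- The graph in which the neighbors of the vertex `u` are listed in `nbr u`. -/
def ofNeighborTable {n m : ℕ} (nbr : Fin n → Fin m → Fin n) (hs : ∀ u k, ∃ l, nbr (nbr u k) l = u)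
    (hl : ∀ u k, nbr u k ≠ u) : SimpleGraph (Fin n) where
  Adj u v := ∃ k, nbr u k = v
  symm := ⟨by rintro u _ ⟨k, rfl⟩; exact hs u k⟩
  loopless := ⟨by rintro u ⟨k, hk⟩; exact hl u k hk⟩

instance {n m : ℕ} (nbr : Fin n → Fin m → Fin n) (hs hl) :
    DecidableRel (ofNeighborTable nbr hs hl).Adj :=
  fun u v => inferInstanceAs (Decidable (∃ k, nbr u k = v))

/-- The function on pairs of vertices that takes the value `col u k` at `u` and its `k`-th
neighbor. -/
def tableColoring {n c : ℕ} (nbr : Fin n → Fin 3 → Fin n) (col : Fin n → Fin 3 → Fin (c + 1))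
    (u v : Fin n) : Fin (c + 1) :=
  if nbr u 0 = v then col u 0 else if nbr u 1 = v then col u 1 else
    if nbr u 2 = v then col u 2 else 0

end NeighborTables

/-! ### The pair on 16 vertices -/

section BasePair

/-- A cubic graph of chromatic index 3 on 16 vertices. -/
def classOneGraph : SimpleGraph (Fin 16) :=
  ofNeighborTable (![![8, 9, 10],
    ![12, 2, 3],
    ![1, 5, 3],
    ![1, 2, 10],
    ![14, 12, 5],
    ![2, 4, 7],
    ![13, 15, 7],
    ![5, 6, 9],
    ![0, 13, 9],
    ![0, 7, 8],
    ![0, 3, 11],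
    ![10, 14, 15],
    ![1, 4, 13],
    ![6, 8, 12],
    ![4, 11, 15],
    ![6, 11, 14]] :
      Fin 16 → Fin 3 → Fin 16) (by decide) (by decide)

/-- A cubic graph of chromatic index 4 on 16 vertices: the Petersen graph with three of its
vertices replaced by triangles. -/
def classTwoGraph : SimpleGraph (Fin 16) :=
  ofNeighborTable (![![8, 9, 3],
    ![10, 2, 3],
    ![1, 14, 3],
    ![0, 1, 2],
    ![11, 10, 5],
    ![4, 7, 12],
    ![13, 11, 15],
    ![5, 9, 15],
    ![0, 13, 9],
    ![0, 7, 8],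
    ![1, 4, 11],
    ![4, 6, 10],
    ![5, 14, 13],
    ![6, 8, 12],
    ![2, 12, 15],
    ![6, 7, 14]] :
      Fin 16 → Fin 3 → Fin 16) (by decide) (by decide)

instance : DecidableRel classOneGraph.Adj := by unfold classOneGraph; infer_instance

instance : DecidableRel classTwoGraph.Adj := by unfold classTwoGraph; infer_instance

theorem isCubic_classOneGraph : classOneGraph.IsCubic :=
  isCubic_iff.2 (by decide +kernel)

theorem isCubic_classTwoGraph : classTwoGraph.IsCubic :=
  isCubic_iff.2 (by decide +kernel)

theorem edgeColorableBy_classOneGraph : classOneGraph.EdgeColorableBy (Fin 3) :=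
  ⟨tableColoring
    ![![8, 9, 10],
    ![12, 2, 3],
    ![1, 5, 3],
    ![1, 2, 10],
    ![14, 12, 5],
    ![2, 4, 7],
    ![13, 15, 7],
    ![5, 6, 9],
    ![0, 13, 9],
    ![0, 7, 8],
    ![0, 3, 11],
    ![10, 14, 15],
    ![1, 4, 13],
    ![6, 8, 12],
    ![4, 11, 15],
    ![6, 11, 14]]
    ![![0, 1, 2],
    ![0, 1, 2],
    ![1, 2, 0],
    ![2, 0, 1],
    ![2, 1, 0],
    ![2, 0, 1],
    ![0, 1, 2],
    ![1, 2, 0],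
    ![0, 1, 2],
    ![1, 0, 2],
    ![2, 1, 0],
    ![0, 1, 2],
    ![0, 1, 2],
    ![0, 1, 2],
    ![2, 1, 0],
    ![1, 2, 0]],
    by decide +kernel, by decide +kernel⟩

theorem edgeColorableBy_classTwoGraph : classTwoGraph.EdgeColorableBy (Fin 4) :=
  ⟨tableColoring
    ![![8, 9, 3],
    ![10, 2, 3],
    ![1, 14, 3],
    ![0, 1, 2],
    ![11, 10, 5],
    ![4, 7, 12],
    ![13, 11, 15],
    ![5, 9, 15],
    ![0, 13, 9],
    ![0, 7, 8],
    ![1, 4, 11],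
    ![4, 6, 10],
    ![5, 14, 13],
    ![6, 8, 12],
    ![2, 12, 15],
    ![6, 7, 14]]
    ![![0, 1, 2],
    ![0, 1, 3],
    ![1, 2, 0],
    ![2, 3, 0],
    ![0, 1, 2],
    ![2, 0, 1],
    ![0, 1, 2],
    ![0, 2, 1],
    ![0, 1, 3],
    ![1, 2, 3],
    ![0, 1, 2],
    ![0, 1, 2],
    ![1, 0, 2],
    ![0, 1, 2],
    ![2, 0, 3],
    ![2, 1, 3]],
    by decide +kernel, by decide +kernel⟩

-- The variables are the colors of the 24 edges. Each is compared at once with the earlier edges it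
-- meets, so the evaluation prunes early instead of visiting 3 ^ 24 assignments.
set_option synthInstance.maxHeartbeats 400000 in
set_option synthInstance.maxSize 1000 in
set_option maxRecDepth 10000 in
theorem classTwoGraph_three_coloring_search :
    ∀ x0 : Fin 3,
    ∀ x1 : Fin 3, x0 ≠ x1 →
    ∀ x2 : Fin 3, x0 ≠ x2 → x1 ≠ x2 →
    ∀ x3 : Fin 3, x0 ≠ x3 → x1 ≠ x3 →
    ∀ x4 : Fin 3, x1 ≠ x4 → x3 ≠ x4 →
    ∀ x5 : Fin 3, x0 ≠ x5 → x3 ≠ x5 →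
    ∀ x6 : Fin 3, x2 ≠ x6 →
    ∀ x7 : Fin 3, x2 ≠ x7 → x6 ≠ x7 →
    ∀ x8 : Fin 3, x6 ≠ x8 → x7 ≠ x8 →
    ∀ x9 : Fin 3, x6 ≠ x9 → x8 ≠ x9 →
    ∀ x10 : Fin 3, x7 ≠ x10 → x8 ≠ x10 →
    ∀ x11 : Fin 3, x9 ≠ x11 →
    ∀ x12 : Fin 3, x9 ≠ x12 → x11 ≠ x12 →
    ∀ x13 : Fin 3, x11 ≠ x13 → x12 ≠ x13 →
    ∀ x14 : Fin 3, x11 ≠ x14 → x13 ≠ x14 →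
    ∀ x15 : Fin 3, x12 ≠ x15 → x13 ≠ x15 →
    ∀ x16 : Fin 3, x4 ≠ x16 → x14 ≠ x16 →
    ∀ x17 : Fin 3, x14 ≠ x17 → x16 ≠ x17 →
    ∀ x18 : Fin 3, x4 ≠ x18 → x16 ≠ x18 →
    ∀ x19 : Fin 3, x5 ≠ x19 → x15 ≠ x19 →
    ∀ x20 : Fin 3, x15 ≠ x20 → x18 ≠ x20 → x19 ≠ x20 →
    ∀ x21 : Fin 3, x5 ≠ x21 → x17 ≠ x21 → x19 ≠ x21 →
    ∀ x22 : Fin 3, x10 ≠ x22 → x17 ≠ x22 → x21 ≠ x22 →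
    ∀ x23 : Fin 3, x10 ≠ x23 → x18 ≠ x23 → x20 ≠ x23 → x22 ≠ x23 → False := by
  decide +kernel

theorem not_edgeColorableBy_classTwoGraph : ¬ classTwoGraph.EdgeColorableBy (Fin 3) := by
  rintro ⟨f, hf⟩
  have ne : ∀ a b c d, (classTwoGraph.Adj a b ∧ classTwoGraph.Adj c d ∧ s(a, b) ≠ s(c, d) ∧
      (a = c ∨ a = d ∨ b = c ∨ b = d)) → f a b ≠ f c d := by
    rintro a b c d ⟨hab, hcd, hne, rfl | rfl | rfl | rfl⟩
    · exact hf.ne _ _ _ hab hcd fun h => hne (by rw [h])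
    · rw [hf.symm c a]
      exact hf.ne _ _ _ hab hcd.symm fun h => hne (by rw [h, Sym2.eq_swap])
    · rw [hf.symm a b]
      exact hf.ne _ _ _ hab.symm hcd fun h => hne (by rw [h, Sym2.eq_swap])
    · rw [hf.symm a b, hf.symm c b]
      exact hf.ne _ _ _ hab.symm hcd.symm fun h => hne (by rw [h])
  exact classTwoGraph_three_coloring_search
    (f 0 8)
    (f 0 9) (ne 0 8 0 9 (by decide))
    (f 0 3) (ne 0 8 0 3 (by decide)) (ne 0 9 0 3 (by decide))
    (f 8 9) (ne 0 8 8 9 (by decide)) (ne 0 9 8 9 (by decide))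
    (f 7 9) (ne 0 9 7 9 (by decide)) (ne 8 9 7 9 (by decide))
    (f 8 13) (ne 0 8 8 13 (by decide)) (ne 8 9 8 13 (by decide))
    (f 1 3) (ne 0 3 1 3 (by decide))
    (f 2 3) (ne 0 3 2 3 (by decide)) (ne 1 3 2 3 (by decide))
    (f 1 2) (ne 1 3 1 2 (by decide)) (ne 2 3 1 2 (by decide))
    (f 1 10) (ne 1 3 1 10 (by decide)) (ne 1 2 1 10 (by decide))
    (f 2 14) (ne 2 3 2 14 (by decide)) (ne 1 2 2 14 (by decide))
    (f 4 10) (ne 1 10 4 10 (by decide))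
    (f 10 11) (ne 1 10 10 11 (by decide)) (ne 4 10 10 11 (by decide))
    (f 4 11) (ne 4 10 4 11 (by decide)) (ne 10 11 4 11 (by decide))
    (f 4 5) (ne 4 10 4 5 (by decide)) (ne 4 11 4 5 (by decide))
    (f 6 11) (ne 10 11 6 11 (by decide)) (ne 4 11 6 11 (by decide))
    (f 5 7) (ne 7 9 5 7 (by decide)) (ne 4 5 5 7 (by decide))
    (f 5 12) (ne 4 5 5 12 (by decide)) (ne 5 7 5 12 (by decide))
    (f 7 15) (ne 7 9 7 15 (by decide)) (ne 5 7 7 15 (by decide))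
    (f 6 13) (ne 8 13 6 13 (by decide)) (ne 6 11 6 13 (by decide))
    (f 6 15) (ne 6 11 6 15 (by decide)) (ne 7 15 6 15 (by decide)) (ne 6 13 6 15 (by decide))
    (f 12 13) (ne 8 13 12 13 (by decide)) (ne 5 12 12 13 (by decide)) (ne 6 13 12 13 (by decide))
    (f 12 14) (ne 2 14 12 14 (by decide)) (ne 5 12 12 14 (by decide)) (ne 12 13 12 14 (by decide))
    (f 14 15) (ne 2 14 14 15 (by decide)) (ne 7 15 14 15 (by decide)) (ne 6 15 14 15 (by decide)) (ne 12 14 14 15 (by decide))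

/-- A matrix that intertwines the adjacency matrices of `classOneGraph` and `classTwoGraph`. -/
def intertwiner : Matrix (Fin 16) (Fin 16) ℤ :=
  ![![-1, 0, 0, 0, 1, 0, 0, 0, -1, -1, 1, 1, 0, 0, 0, 1],
    ![1, 0, 0, 0, -1, 0, -1, 1, 1, 1, -1, -1, 0, 1, 0, 0],
    ![1, -1, 0, 1, -1, 0, 0, 0, 1, 1, -1, -1, 0, 1, 0, 0],
    ![1, 0, 0, 0, -1, 0, 0, 0, 1, 1, -1, -1, 1, 0, 0, 0],
    ![1, 0, 0, 0, -1, 0, 0, 0, 0, 1, 0, 0, -1, 0, 0, 1],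
    ![1, 0, 0, 0, 0, -1, 1, 0, 1, 0, -1, 0, 0, 0, 0, 0],
    ![0, 0, 0, 0, 1, 0, 0, 0, 0, -1, 1, 0, 1, 0, 0, -1],
    ![-1, 0, 0, 0, 0, 0, 0, -1, 0, 0, 1, 1, 0, 1, 0, 0],
    ![-1, 0, 0, 0, 1, 1, 1, 0, -1, -1, 1, 1, 0, -1, 0, 0],
    ![-1, 1, 0, -1, 1, 0, 1, 0, -1, -1, 1, 1, 0, 0, 0, 0],
    ![0, 0, 0, 0, 0, 0, 0, 0, 0, 0, 0, 0, 0, 0, 1, 0],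
    ![0, 0, 1, 0, 0, 0, 0, 0, 0, 0, 0, 0, 0, 0, 0, 0],
    ![0, 0, 0, 0, 0, 0, 0, 1, 1, 1, 0, -1, 0, -1, 0, 0],
    ![0, 0, 0, 0, 1, 1, -1, 0, -1, 0, 0, 1, 0, 0, 0, 0],
    ![0, 0, 0, 1, 0, -1, 0, 1, 0, 0, 0, 0, 0, 0, 0, 0],
    ![0, 1, 0, 0, 0, 1, 0, -1, 0, 0, 0, 0, 0, 0, 0, 0]]

/-- The inverse of `intertwiner`, up to the factor 87. -/
def intertwinerInv : Matrix (Fin 16) (Fin 16) ℤ :=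
  ![![-3, 1, 1, 3, 45, 16, 42, -16, -1, -1, 0, 0, -13, 13, -2, 2],
    ![-4, 11, -18, 4, 2, 2, -2, -2, -11, 18, 0, 0, 2, -2, 36, 51],
    ![0, 0, 0, 0, 0, 0, 0, 0, 0, 0, 0, 87, 0, 0, 0, 0],
    ![4, -11, 18, -4, -2, -2, 2, 2, 11, -18, 0, 0, -2, 2, 51, 36],
    ![24, -37, 50, -24, -12, 17, 12, -17, -50, 37, 0, 0, 46, 41, -13, 13],
    ![2, 38, 9, -2, -1, -1, 1, 1, 49, -9, 0, 0, -1, 1, -18, 18],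
    ![-10, -16, 42, 10, 5, 5, -5, -5, 16, 45, 0, 0, 5, -5, 3, -3],
    ![-2, 49, -9, 2, 1, 1, -1, -1, 38, 9, 0, 0, 1, -1, 18, -18],
    ![18, 52, -35, -18, -9, 49, 9, 38, 35, -52, 0, 0, 20, -20, -17, 17],
    ![-24, -50, 37, 24, 12, -17, -12, 17, -37, 50, 0, 0, 41, 46, 13, -13],
    ![3, -1, -1, -3, 42, -16, 45, 16, 1, 1, 0, 0, 13, -13, 2, -2],
    ![-18, 35, -52, 18, 9, 38, -9, 49, 52, -35, 0, 0, -20, 20, 17, -17],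
    ![18, -6, -6, 69, -9, -9, 9, 9, 6, 6, 0, 0, -9, 9, 12, -12],
    ![10, 16, 45, -10, -5, -5, 5, 5, -16, 42, 0, 0, -5, 5, -3, 3],
    ![0, 0, 0, 0, 0, 0, 0, 0, 0, 0, 87, 0, 0, 0, 0, 0],
    ![69, 6, 6, 18, 9, 9, -9, -9, -6, -6, 0, 0, 9, -9, -12, 12]]

theorem intertwiner_mul_inv : intertwiner * intertwinerInv = 87 := by
  have h : ∀ i j, ∑ k, intertwiner i k * intertwinerInv k j = if i = j then 87 else 0 := by
    decide +kernel
  ext i j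
  rw [Matrix.mul_apply, h, ← Nat.cast_ofNat (R := Matrix (Fin 16) (Fin 16) ℤ), ← diagonal_natCast,
    diagonal_apply]
  norm_num

theorem adjMatrix_mul_intertwiner :
    classOneGraph.adjMatrix ℤ * intertwiner = intertwiner * classTwoGraph.adjMatrix ℤ := by
  have h : ∀ i j, ∑ k, (if classOneGraph.Adj i k then 1 else 0) * intertwiner k j =
      ∑ k, intertwiner i k * (if classTwoGraph.Adj k j then 1 else 0) := by
    decide +kernel
  ext i j
  simpa only [Matrix.mul_apply, adjMatrix_apply] using h i j

/-- An invertible intertwiner makes the two matrices similar. Its identities are evaluated over ℤ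
and mapped to ℝ, where 87 is a unit. -/
theorem charpoly_classOneGraph_eq :
    (classOneGraph.adjMatrix ℝ).charpoly = (classTwoGraph.adjMatrix ℝ).charpoly := by
  let φ := (Int.castRingHom ℝ).mapMatrix (m := Fin 16)
  have hA : ∀ (G : SimpleGraph (Fin 16)) [DecidableRel G.Adj],
      φ (G.adjMatrix ℤ) = G.adjMatrix ℝ := by
    intro G _
    ext i j
    simp [φ, adjMatrix_apply, apply_ite]
  have h1 : φ intertwiner * ((87 : ℝ)⁻¹ • φ intertwinerInv) = 1 := by
    rw [Matrix.mul_smul, ← map_mul, intertwiner_mul_inv, map_ofNat,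
      ← Nat.cast_ofNat (R := Matrix (Fin 16) (Fin 16) ℝ), ← nsmul_one, ← Nat.cast_smul_eq_nsmul ℝ,
      smul_smul]
    norm_num
  have h2 := congrArg φ adjMatrix_mul_intertwiner
  rw [map_mul, map_mul, hA, hA] at h2
  let U : (Matrix (Fin 16) (Fin 16) ℝ)ˣ :=
    ⟨φ intertwiner, (87 : ℝ)⁻¹ • φ intertwinerInv, h1, mul_eq_one_comm.1 h1⟩
  have h3 : classOneGraph.adjMatrix ℝ = U.val * classTwoGraph.adjMatrix ℝ * U⁻¹.val := by
    rw [Units.eq_mul_inv_iff_mul_eq]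
    exact h2
  rw [h3, coe_units_inv, charpoly_units_conj]

end BasePair

/-! ### Iterating truncation -/

section Sequence

/-- `G` and `H` are cubic graphs with the same characteristic polynomial such that the edges of `G`,
but not those of `H`, can be colored with three colors, and those of `H` with four. -/
structure IsCospectralClassPair {V W : Type*} [Fintype V] [DecidableEq V] [Fintype W]
    [DecidableEq W] (G : SimpleGraph V) (H : SimpleGraph W) : Prop where
  cubic_left : G.IsCubic
  cubic_right : H.IsCubic
  -- Quantifying over the instances lets classical and concrete decidability be used
  -- interchangeably.
  charpoly_eq : ∀ [DecidableRel G.Adj] [DecidableRel H.Adj],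
    (G.adjMatrix ℝ).charpoly = (H.adjMatrix ℝ).charpoly
  colorable_left : G.EdgeColorableBy (Fin 3)
  colorable_right : H.EdgeColorableBy (Fin 4)
  not_colorable_right : ¬ H.EdgeColorableBy (Fin 3)

section

variable {V W V' W' : Type*} [Fintype V] [DecidableEq V] [Fintype W] [DecidableEq W]
  [Fintype V'] [DecidableEq V'] [Fintype W'] [DecidableEq W']
  {G : SimpleGraph V} {H : SimpleGraph W} {G' : SimpleGraph V'} {H' : SimpleGraph W'}

theorem charpoly_adjMatrix_of_iso [DecidableRel G.Adj] [DecidableRel G'.Adj] (e : G ≃g G') :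
    (G.adjMatrix ℝ).charpoly = (G'.adjMatrix ℝ).charpoly := by
  rw [← Matrix.charpoly_reindex e.toEquiv (G.adjMatrix ℝ)]
  congr 1
  ext i j
  simp only [reindex_apply, submatrix_apply, adjMatrix_apply]
  exact if_congr e.symm.map_adj_iff rfl rfl

theorem IsCospectralClassPair.of_iso (h : IsCospectralClassPair G H) (e : G' ≃g G) (e' : H' ≃g H) :
    IsCospectralClassPair G' H' where
  cubic_left := h.cubic_left.of_iso e
  cubic_right := h.cubic_right.of_iso e'
  charpoly_eq := by
    classical
    intro _ _
    rw [charpoly_adjMatrix_of_iso e, charpoly_adjMatrix_of_iso e', h.charpoly_eq]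
  colorable_left := h.colorable_left.of_iso e
  colorable_right := h.colorable_right.of_iso e'
  not_colorable_right h' := h.not_colorable_right (h'.of_iso e'.symm)

theorem IsCospectralClassPair.truncation [DecidableRel G.Adj] [DecidableRel H.Adj]
    (h : IsCospectralClassPair G H) : IsCospectralClassPair G.truncation H.truncation where
  cubic_left := h.cubic_left.truncation
  cubic_right := h.cubic_right.truncation
  charpoly_eq := charpoly_truncation_congr h.cubic_left h.cubic_right h.charpoly_eq
  colorable_left := h.colorable_left.truncation h.cubic_left
  colorable_right := h.colorable_right.truncation h.cubic_right
  not_colorable_right h' := h.not_colorable_right (h'.of_truncation h.cubic_right)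

theorem IsCospectralClassPair.cospectral (h : IsCospectralClassPair G H) : Cospectral G H := by
  classical
  exact congrArg roots h.charpoly_eq

theorem IsCospectralClassPair.chromaticIndex_left [Nonempty V] (h : IsCospectralClassPair G H) :
    G.chromaticIndex = 3 :=
  chromaticIndex_eq_succ h.colorable_left fun h' =>
    h.cubic_left.not_edgeColorableBy_two (exists_isProperEdgeColoring_iff.1 h')

theorem IsCospectralClassPair.chromaticIndex_right (h : IsCospectralClassPair G H) :
    H.chromaticIndex = 4 :=
  chromaticIndex_eq_succ h.colorable_right fun h' =>
    h.not_colorable_right (exists_isProperEdgeColoring_iff.1 h')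

end

theorem isCospectralClassPair_base : IsCospectralClassPair classOneGraph classTwoGraph where
  cubic_left := isCubic_classOneGraph
  cubic_right := isCubic_classTwoGraph
  charpoly_eq := by
    intro _ _
    convert charpoly_classOneGraph_eq
  colorable_left := edgeColorableBy_classOneGraph
  colorable_right := edgeColorableBy_classTwoGraph
  not_colorable_right := not_edgeColorableBy_classTwoGraph

/-- Iterated truncation of the base pair. -/
theorem exists_isCospectralClassPair (i : ℕ) :
    ∃ G H : SimpleGraph (Fin (3 ^ i * 16)), IsCospectralClassPair G H := by
  classical
  induction i with
  | zero => exact ⟨classOneGraph, classTwoGraph, isCospectralClassPair_base⟩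
  | succ i ih =>
    obtain ⟨G, H, h⟩ := ih
    have card_dart : ∀ K : SimpleGraph (Fin (3 ^ i * 16)), K.IsCubic →
        Fintype.card (Fin (3 ^ (i + 1) * 16)) = Fintype.card K.Dart := by
      intro K hK
      rw [hK.card_dart, Fintype.card_fin, Fintype.card_fin]
      ring
    -- Darts are renumbered by `Fin`, so that the induction stays within one family of vertex types.
    let eG := Fintype.equivOfCardEq (card_dart G h.cubic_left)
    let eH := Fintype.equivOfCardEq (card_dart H h.cubic_right)
    exact ⟨_, _, h.truncation.of_iso (Iso.comap eG G.truncation) (Iso.comap eH H.truncation)⟩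

end Sequence

end SimpleGraph

theorem mainTheorem1 :
    ∃ (n : ℕ → ℕ) (G H : (i : ℕ) → SimpleGraph (Fin (n i))),
      (∀ i : ℕ,
        (G i).IsCubic ∧ (H i).IsCubic ∧
        SimpleGraph.Cospectral (G i) (H i) ∧
        (G i).chromaticIndex = 3 ∧ (H i).chromaticIndex = 4) ∧
      ∀ i j : ℕ, i ≠ j → IsEmpty (G i ≃g G j) ∧ IsEmpty (H i ≃g H j) := by
  choose G H h using SimpleGraph.exists_isCospectralClassPair
  have hcard : ∀ i j : ℕ, i ≠ j → IsEmpty (Fin (3 ^ i * 16) ≃ Fin (3 ^ j * 16)) := by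
    refine fun i j hij => ⟨fun e => hij ?_⟩
    have := Fintype.card_congr e
    rw [Fintype.card_fin, Fintype.card_fin] at this
    exact Nat.pow_right_injective (by norm_num : 1 < 3) (Nat.eq_of_mul_eq_mul_right (by norm_num) this)
  refine ⟨fun i => 3 ^ i * 16, G, H, fun i => ?_, fun i j hij => ?_⟩
  · have : Nonempty (Fin (3 ^ i * 16)) := ⟨⟨0, by positivity⟩⟩
    exact ⟨(h i).cubic_left, (h i).cubic_right, (h i).cospectral, (h i).chromaticIndex_left,
      (h i).chromaticIndex_right⟩
  · exact ⟨⟨fun e => (hcard i j hij).false e.toEquiv⟩, ⟨fun e => (hcard i j hij).false e.toEquiv⟩⟩
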